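/- Conventions. A contextuality scenario $H$ is a hypergraph with a finite vertex set $V(H)$ and a set of edges $E(H)\subseteq 2^{V(H)}$ with $\bigcup_{e\in E(H)}e=V(H)$. A probabilistic model on $H$ is a map $p:V(H)\to[0,1]$ with $\sum_{v\in e}p(v)=1$ for all $e\in E(H)$; $\mathcal G(H)$ is the set of these. Write $u\perp v$ if $u\neq v$ and some edge contains both $u$ and $v$. A model $p\in\mathcal G(H)$ lies in $\mathcal{CE}^1(H)$ if $\sum_{v\in I}p(v)\le 1$ for every set $I\subseteq V(H)$ of pairwise orthogonal vertices. The Foulis–Randall product $A\otimes B$ has vertex set $V(A)\times V(B)$; its edges are the sets $\bigcup_{a\in e}\{a\}\times f(a)$ with $e\in E(A)$, $f:e\to E(B)$, and the sets $\bigcup_{b\in e}f(b)\times\{b\}$ with $e\in E(B)$, $f:e\to E(A)$. For $n\ge 1$, $H^{\otimes n}$ is the $n$-fold iterated Foulis–Randall product of copies of $H$, $p^{\otimes n}(v_1,\dots,v_n)=p(v_1)\cdots p(v_n)$, and $p\in\mathcal{CE}^n(H)$ means that $p\in\mathcal G(H)$ and $p^{\otimes n}\in\mathcal{CE}^1(H^{\otimes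 n})$. Let $\mathcal{CE}^\infty(H)=\bigcap_{n\ge 1}\mathcal{CE}^n(H)$. $\mathcal Q_n(H)$, $n\geq 1$, is the set of all $p:V(H)\to[0,1]$ for which there is a complex positive semidefinite matrix $M$, with rows and columns indexed by the words of length at most $n$ over $V(H)$ (including the empty word $\emptyset$), such that $M_{\emptyset,\emptyset}=1$; $\sum_{x\in e}M_{\mathbf vx,\mathbf w}=M_{\mathbf v,\mathbf w}$ for all $e\in E(H)$ and all words $\mathbf v,\mathbf w$ of length at most $n-1$ and at most $n$, respectively; $M_{\mathbf vx,\mathbf wy}=0$ for all words $\mathbf v,\mathbf w$ of length at most $n-1$ and all vertices $x\perp y$; and $p(v)=M_{v,\emptyset}$ for all $v\in V(H)$. For $n$ divisible by $4$, $J_n$ is the scenario whose vertices are the $3$-element subsets of $\{1,\dots,n\}$ and in which every partition of $\{1,\dots,n\}$ into $4$-element subsets gives an edge, consisting of all $3$-element sets contained in one of the parts. Theorem. (1) There is a contextuality scenario $H$ with $\mathcal Q_1(H)\subsetneq\mathcal{CE}^\infty(H)$. (2) Let $n\ge 12$ be divisible by $4$. Then the uniform model $p_J(v)=\tfrac1n$,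 $v\in V(J_n)$, lies in $\mathcal{CE}^\infty(J_n)$, whereas $\mathcal Q_1(J_n)=\emptyset$. -/

import Mathlib

universe u

/-- A (finite) contextuality scenario: a hypergraph on a finite set of vertices (outcomes) whose
edges (measurements) cover the vertex set. -/
structure ContextualityScenario where
  /-- The vertices, i.e. outcomes. -/
  V : Type u
  /-- Only finite scenarios are considered. -/
  finite : Finite V
  /-- The edges, i.e. measurements. -/
  edges : Set (Finset V)
  /-- Every vertex lies in some edge. -/
  covers : ∀ v : V, ∃ e ∈ edges, v ∈ e

namespace ContextualityScenario

/-- `𝒢(H)`: the probabilistic models on `H`. -/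
def probModels (H : ContextualityScenario.{u}) : Set (H.V → ℝ) :=
  {p | (∀ v, p v ∈ Set.Icc (0 : ℝ) 1) ∧ ∀ e ∈ H.edges, ∑ v ∈ e, p v = 1}

/-- Orthogonality: two different vertices that belong to a common edge. -/
def Orthogonal (H : ContextualityScenario.{u}) (u v : H.V) : Prop :=
  u ≠ v ∧ ∃ e ∈ H.edges, u ∈ e ∧ v ∈ e

/-- The non-orthogonality graph `NO(H)`: two vertices are adjacent if and only if no edge contains
both. (Since the edges cover `V`, such vertices are automatically different.) -/
def nonOrthogonalityGraph (H : ContextualityScenario.{u}) : SimpleGraph H.V where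
  Adj u v := ¬ ∃ e ∈ H.edges, u ∈ e ∧ v ∈ e
  symm := ⟨fun _ _ h ⟨e, he, hv, hu⟩ => h ⟨e, he, hu, hv⟩⟩
  loopless := ⟨fun v h => by
    obtain ⟨e, he, hv⟩ := H.covers v
    exact h ⟨e, he, hv, hv⟩⟩

/-- `𝒞ℰ¹(H)`: the probabilistic models satisfying Consistent Exclusivity. -/
def consistentExclusivity (H : ContextualityScenario.{u}) : Set (H.V → ℝ) :=
  {p | p ∈ H.probModels ∧
    ∀ I : Finset H.V, H.nonOrthogonalityGraph.IsIndepSet (I : Set H.V) → ∑ v ∈ I, p v ≤ 1}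

/-- The Foulis–Randall product `A ⊗ B`. Its edges are the sets `⋃_{a ∈ eA} {a} × f(a)` with
`eA ∈ E(A)` and `f : eA → E(B)`, and the sets `⋃_{b ∈ eB} f(b) × {b}` with `eB ∈ E(B)` and
`f : eB → E(A)`. -/
def tensor (A B : ContextualityScenario.{u}) : ContextualityScenario.{u} where
  V := A.V × B.V
  finite := by
    have := A.finite
    have := B.finite
    infer_instance
  edges :=
    {e | ∃ eA ∈ A.edges, ∃ f : A.V → Finset B.V, (∀ a ∈ eA, f a ∈ B.edges) ∧
        ∀ a b, (a, b) ∈ e ↔ a ∈ eA ∧ b ∈ f a} ∪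
    {e | ∃ eB ∈ B.edges, ∃ f : B.V → Finset A.V, (∀ b ∈ eB, f b ∈ A.edges) ∧
        ∀ a b, (a, b) ∈ e ↔ b ∈ eB ∧ a ∈ f b}
  covers := by
    rintro ⟨a, b⟩
    obtain ⟨eA, hA, ha⟩ := A.covers a
    obtain ⟨eB, hB, hb⟩ := B.covers b
    exact ⟨eA ×ˢ eB, Or.inl ⟨eA, hA, fun _ => eB, fun _ _ => hB, fun _ _ => Finset.mem_product⟩,
      Finset.mem_product.2 ⟨ha, hb⟩⟩

/-- The trivial scenario with one vertex and one edge; the empty product. -/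
def unitScenario : ContextualityScenario.{u} where
  V := PUnit
  finite := inferInstance
  edges := {{PUnit.unit}}
  covers := fun _ => ⟨{PUnit.unit}, rfl, Finset.mem_singleton.2 rfl⟩

/-- The `n`-fold iterated Foulis–Randall product `H^{⊗n} = (⋯(H ⊗ H) ⊗ ⋯) ⊗ H`. -/
def tensorPow (H : ContextualityScenario.{u}) : ℕ → ContextualityScenario.{u}
  | 0 => unitScenario
  | 1 => H
  | n + 2 => (tensorPow H (n + 1)).tensor H

/-- The product assignment `p^{⊗n}(v₁, …, vₙ) = p(v₁) ⋯ p(vₙ)` on `H^{⊗n}`. -/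
def modelPow (H : ContextualityScenario.{u}) (p : H.V → ℝ) : (n : ℕ) → (H.tensorPow n).V → ℝ
  | 0 => fun _ => 1
  | 1 => p
  | n + 2 => fun v => modelPow H p (n + 1) v.1 * p v.2

/-- `𝒞ℰⁿ(H)`. -/
def consistentExclusivityLevel (H : ContextualityScenario.{u}) (n : ℕ) : Set (H.V → ℝ) :=
  {p | p ∈ H.probModels ∧ H.modelPow p n ∈ (H.tensorPow n).consistentExclusivity}

/-- `𝒞ℰ^∞(H)`, the intersection of all `𝒞ℰⁿ(H)`, `n ≥ 1`. -/
def consistentExclusivityInf (H : ContextualityScenario.{u}) : Set (H.V → ℝ) :=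
  ⋂ n ∈ Set.Ici 1, H.consistentExclusivityLevel n

open scoped ComplexOrder in
/-- `𝒬ₙ(H)` for `n ≥ 1`, the `n`-th level of the semidefinite hierarchy. The matrix of the
hierarchy is indexed by the words of length at most `n` over `V(H)`; here `M` is given on all words,
but only its entries at words of length at most `n` are used. -/
def npaLevel (H : ContextualityScenario.{u}) (n : ℕ) : Set (H.V → ℝ) :=
  {p | (∀ v, p v ∈ Set.Icc (0 : ℝ) 1) ∧ ∃ M : Matrix (List H.V) (List H.V) ℂ,
    (M.submatrix (Subtype.val : {w : List H.V // w.length ≤ n} → List H.V)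
      (Subtype.val : {w : List H.V // w.length ≤ n} → List H.V)).PosSemidef ∧
    M [] [] = 1 ∧
    (∀ e ∈ H.edges, ∀ v w : List H.V, v.length + 1 ≤ n → w.length ≤ n →
      ∑ x ∈ e, M (v ++ [x]) w = M v w) ∧
    (∀ v w : List H.V, v.length + 1 ≤ n → w.length + 1 ≤ n → ∀ x y : H.V, H.Orthogonal x y →
      M (v ++ [x]) (w ++ [y]) = 0) ∧
    ∀ v : H.V, (p v : ℂ) = M [v] []}

/-- The scenario `Jₙ`, for `4 ∣ n`. The vertices are the 3-element subsets of an `n`-element set.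
Every partition of the `n`-element set into 4-element subsets gives an edge, which consists of the
vertices contained in one of the parts. -/
def johnson (n : ℕ) (h : 4 ∣ n) : ContextualityScenario.{0} where
  V := {s : Finset (Fin n) // s.card = 3}
  finite := inferInstance
  edges := {e | ∃ P : Finpartition (Finset.univ : Finset (Fin n)),
    (∀ t ∈ P.parts, t.card = 4) ∧ ∀ v, v ∈ e ↔ ∃ t ∈ P.parts, v.1 ⊆ t}
  covers := by
    classical
    rintro ⟨s, hs⟩
    obtain ⟨k, rfl⟩ := h
    have hk : 3 ≤ 4 * k := by
      have := s.card_le_univ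
      simpa [hs] using this
    obtain ⟨t, hst, -, ht⟩ := Finset.exists_subsuperset_card_eq (s.subset_univ) (n := 4)
      (by omega) (by simp; omega)
    obtain ⟨Q, hQ⟩ : ∃ Q : Finpartition tᶜ, ∀ r ∈ Q.parts, r.card = 4 := by
      have hc : (tᶜ).card = 4 * (k - 1) := by
        rw [Finset.card_compl, ht, Fintype.card_fin]; omega
      rcases Nat.eq_zero_or_pos (k - 1) with h0 | h0
      · rw [h0, Nat.mul_zero, Finset.card_eq_zero] at hc
        rw [hc]
        exact ⟨Finpartition.empty _, by simp [Finpartition.empty]⟩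
      · obtain ⟨Q, hQe, hQc⟩ := Finpartition.exists_equipartition_card_eq tᶜ
          (n := k - 1) (by omega) (by omega)
        refine ⟨Q, fun r hr => ?_⟩
        have h4 : (tᶜ).card / Q.parts.card = 4 := by
          rw [hQc, hc]; exact Nat.mul_div_cancel _ h0
        have hle := hQe.average_le_card_part hr
        rw [h4] at hle
        refine le_antisymm ?_ hle
        by_contra! hlt
        have hsum := Q.sum_card_parts
        have : ∑ i ∈ Q.parts, 4 < ∑ i ∈ Q.parts, i.card :=
          Finset.sum_lt_sum (fun i hi => by
            have := hQe.average_le_card_part hi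
            rwa [h4] at this) ⟨r, hr, hlt⟩
        rw [Finset.sum_const, hQc, smul_eq_mul, hsum, hc] at this
        omega
    have ht0 : t ≠ ⊥ := by
      rintro rfl
      simp at ht
    let P : Finpartition (Finset.univ : Finset (Fin (4 * k))) :=
      Q.extend ht0 disjoint_compl_left (by simp)
    refine ⟨Finset.univ.filter fun v => ∃ r ∈ P.parts, v.1 ⊆ r, ⟨P, ?_, fun v => by simp⟩, ?_⟩
    · intro r hr
      rcases Finset.mem_insert.1 hr with rfl | hr
      · exact ht
      · exact hQ r hr
    · exact Finset.mem_filter.2 ⟨Finset.mem_univ _, t, Finset.mem_insert_self _ _, hst⟩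

end ContextualityScenario

/-! Membership in `𝒞ℰ^∞` is Haemers' bound over the field with two elements. The indicator vector of
a triple has square 1, and orthogonal triples meet in 0 or 2 points, so their vectors are
orthogonal. Tensor products of these vectors are orthonormal on every pairwise orthogonal set of the
`m`-th power, hence linearly independent (`HasOrthonormalRep.card_le`). Such a set has at most `n^m`
elements, each of weight `n^{-m}`.

Emptiness of `𝒬₁` (`johnson_npaLevel_one`) follows by summing a feasible matrix over the symmetric
group. The resulting entry depends only on the intersection size and vanishes at sizes 0 and 2; let
`a` be its value at size 1. Summed over an edge against a triple `x` inside no block, it gives `a`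
times the number of vertices of the edge meeting `x` once: `5a` if the blocks split `x` as 2+1, `9a`
if as 1+1+1. Both equal the summed entry at `(∅, x)`, which is the same for all `x` and thus zero,
contradicting `M_{∅,∅} = 1`. The case `n = 12` gives the first claim. -/

namespace ContextualityScenario

/-! ### Product models and Haemers' bound. -/

section FoulisRandall

variable {A B : ContextualityScenario.{u}}

theorem tensor_mem_probModels {p : A.V → ℝ} {q : B.V → ℝ} (hp : p ∈ A.probModels)
    (hq : q ∈ B.probModels) :
    (fun v : (A.tensor B).V => p v.1 * q v.2) ∈ (A.tensor B).probModels := by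
  refine ⟨fun v => ⟨mul_nonneg (hp.1 v.1).1 (hq.1 v.2).1,
    mul_le_one₀ (hp.1 v.1).2 (hq.1 v.2).1 (hq.1 v.2).2⟩, ?_⟩
  rintro e (⟨eA, hA, f, hf, he⟩ | ⟨eB, hB, f, hf, he⟩)
  · refine (Finset.sum_finset_product (f := fun v => p v.1 * q v.2) e eA f
      fun v => he v.1 v.2).trans ?_
    rw [← hp.2 eA hA]
    refine Finset.sum_congr rfl fun a ha => ?_
    exact (Finset.mul_sum (f a) q (p a)).symm.trans (by rw [hq.2 _ (hf a ha), mul_one])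
  · refine (Finset.sum_finset_product_right (f := fun v => p v.1 * q v.2) e eB f
      fun v => he v.1 v.2).trans ?_
    rw [← hq.2 eB hB]
    refine Finset.sum_congr rfl fun b hb => ?_
    exact (Finset.sum_mul (f b) p (q b)).symm.trans (by rw [hp.2 _ (hf b hb), one_mul])

theorem modelPow_mem_probModels {H : ContextualityScenario.{u}} {p : H.V → ℝ}
    (hp : p ∈ H.probModels) : ∀ n, H.modelPow p n ∈ (H.tensorPow n).probModels
  | 0 => ⟨fun _ => ⟨zero_le_one, le_rfl⟩, by
      rintro e rfl
      exact Finset.sum_singleton _ _⟩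
  | 1 => hp
  | n + 2 => tensor_mem_probModels (modelPow_mem_probModels hp (n + 1)) hp

theorem modelPow_const (H : ContextualityScenario.{u}) (c : ℝ) :
    ∀ (n : ℕ) (v : (H.tensorPow n).V), H.modelPow (fun _ => c) n v = c ^ n
  | 0, _ => (pow_zero c).symm
  | 1, _ => (pow_one c).symm
  | n + 2, v => by
      rw [pow_succ, ← modelPow_const H c (n + 1) v.1]
      rfl

/-- An assignment of vectors of `Kᵏ` to the vertices that is orthonormal, for the standard bilinear
form, on every edge. For a finite field `K` it witnesses Haemers' bound. -/
def HasOrthonormalRep (H : ContextualityScenario.{u}) (K : Type) [Field K] (k : ℕ) : Prop :=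
  ∃ (ι : Type) (_ : Fintype ι) (w : H.V → ι → K), Fintype.card ι = k ∧
    (∀ v, w v ⬝ᵥ w v = 1) ∧ ∀ u v, H.Orthogonal u v → w u ⬝ᵥ w v = 0

variable {K : Type} [Field K]

/-- If the coordinates in the factor measured first agree, the other two lie in the single edge that
`f` selects there; if they differ, they are already orthogonal. -/
theorem orthogonal_of_orthogonal_tensor {u v : (A.tensor B).V} (h : (A.tensor B).Orthogonal u v) :
    A.Orthogonal u.1 v.1 ∨ B.Orthogonal u.2 v.2 := by
  obtain ⟨a, b⟩ := u
  obtain ⟨a', b'⟩ := v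
  obtain ⟨hne, e, ⟨eA, hA, f, hf, he⟩ | ⟨eB, hB, f, hf, he⟩, hu, hv⟩ := h
  · obtain ⟨ha, hb⟩ := (he _ _).1 hu
    obtain ⟨ha', hb'⟩ := (he _ _).1 hv
    by_cases haa : a = a'
    · subst haa
      exact Or.inr ⟨fun hbb => hne (Prod.ext rfl hbb), f a, hf a ha, hb, hb'⟩
    · exact Or.inl ⟨haa, eA, hA, ha, ha'⟩
  · obtain ⟨hb, ha⟩ := (he _ _).1 hu
    obtain ⟨hb', ha'⟩ := (he _ _).1 hv
    by_cases hbb : b = b'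
    · subst hbb
      exact Or.inl ⟨fun haa => hne (Prod.ext haa rfl), f b, hf b hb, ha, ha'⟩
    · exact Or.inr ⟨hbb, eB, hB, hb, hb'⟩

theorem HasOrthonormalRep.tensor {k l : ℕ} (hA : A.HasOrthonormalRep K k)
    (hB : B.HasOrthonormalRep K l) : (A.tensor B).HasOrthonormalRep K (k * l) := by
  obtain ⟨ι, _, w, rfl, hw1, hw0⟩ := hA
  obtain ⟨κ, _, z, rfl, hz1, hz0⟩ := hB
  have key : ∀ (a a' : ι → K) (b b' : κ → K),
      (fun i : ι × κ => a i.1 * b i.2) ⬝ᵥ (fun i : ι × κ => a' i.1 * b' i.2) =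
        (a ⬝ᵥ a') * (b ⬝ᵥ b') := by
    intro a a' b b'
    simp only [dotProduct, Fintype.sum_mul_sum, Fintype.sum_prod_type]
    exact Finset.sum_congr rfl fun i _ => Finset.sum_congr rfl fun j _ => by ring
  refine ⟨ι × κ, inferInstance, fun v i => w v.1 i.1 * z v.2 i.2, Fintype.card_prod ι κ,
    fun v => ?_, fun u v h => ?_⟩
  · rw [key, hw1, hz1, one_mul]
  · rw [key]
    rcases orthogonal_of_orthogonal_tensor h with h | h
    · rw [hw0 _ _ h, zero_mul]
    · rw [hz0 _ _ h, mul_zero]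

theorem HasOrthonormalRep.tensorPow {H : ContextualityScenario.{u}} {k : ℕ}
    (hH : H.HasOrthonormalRep K k) : ∀ n, (H.tensorPow n).HasOrthonormalRep K (k ^ n)
  | 0 => ⟨Unit, inferInstance, fun _ _ => 1, by simp, by simp [dotProduct],
      fun _ _ h => absurd rfl h.1⟩
  | 1 => by rwa [pow_one]
  | n + 2 => by
      rw [pow_succ]
      exact (HasOrthonormalRep.tensorPow hH (n + 1)).tensor hH

/-- Pairing a linear relation with `w v` isolates the coefficient of `v`. Unit squares are
essential, since over a finite field nonzero vectors can be isotropic. -/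
theorem HasOrthonormalRep.card_le {H : ContextualityScenario.{u}} {k : ℕ}
    (hH : H.HasOrthonormalRep K k) {I : Finset H.V}
    (hI : H.nonOrthogonalityGraph.IsIndepSet (I : Set H.V)) : I.card ≤ k := by
  obtain ⟨ι, _, w, rfl, hw1, hw0⟩ := hH
  have hli : LinearIndependent K fun v : I => w v := by
    rw [Fintype.linearIndependent_iff]
    intro g hg v
    have h := congrArg (fun x => x ⬝ᵥ w v) hg
    simp only [sum_dotProduct, smul_dotProduct, zero_dotProduct, smul_eq_mul] at h
    rw [Finset.sum_eq_single v, hw1, mul_one] at h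
    · exact h
    · intro u _ huv
      have hne : (u : H.V) ≠ v := fun h => huv (Subtype.ext h)
      rw [hw0 _ _ ⟨hne, not_not.1 (hI u.2 v.2 hne)⟩, mul_zero]
    · simp
  simpa using hli.fintype_card_le_finrank

/-- **Haemers' bound** for consistent exclusivity. -/
theorem HasOrthonormalRep.const_mem_consistentExclusivityInf {H : ContextualityScenario.{u}}
    {k : ℕ} (hk : 0 < k) (hH : H.HasOrthonormalRep K k)
    (hp : (fun _ => 1 / (k : ℝ)) ∈ H.probModels) :
    (fun _ => 1 / (k : ℝ)) ∈ H.consistentExclusivityInf := by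
  simp only [consistentExclusivityInf, Set.mem_iInter]
  refine fun n _ => ⟨hp, modelPow_mem_probModels hp n, fun I hI => ?_⟩
  have hcard : (I.card : ℝ) ≤ (k : ℝ) ^ n := by exact_mod_cast (hH.tensorPow n).card_le hI
  have hpos : (0 : ℝ) < (k : ℝ) ^ n := by positivity
  simp only [modelPow_const, Finset.sum_const, nsmul_eq_mul, one_div, inv_pow]
  rwa [← div_eq_mul_inv, div_le_one hpos]

end FoulisRandall

/-! ### The scenarios `Jₙ`. -/

section Johnson

variable {n : ℕ} (h4 : 4 ∣ n)

/-- In a partition into 4-element sets, the vertex that misses exactly the element `i` of the part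
of `i`. -/
def johnsonErase {P : Finpartition (Finset.univ : Finset (Fin n))}
    (hP : ∀ t ∈ P.parts, t.card = 4) (i : Fin n) : (johnson n h4).V :=
  ⟨(P.part i).erase i, by
    rw [Finset.card_erase_of_mem (P.mem_part (Finset.mem_univ i)),
      hP _ (P.part_mem.2 (Finset.mem_univ i))]⟩

theorem johnsonErase_injective {P : Finpartition (Finset.univ : Finset (Fin n))}
    (hP : ∀ t ∈ P.parts, t.card = 4) : Function.Injective (johnsonErase h4 hP) := by
  intro i j hij
  have hij' : (P.part i).erase i = (P.part j).erase j := congrArg Subtype.val hij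
  have hi := P.part_mem.2 (Finset.mem_univ i)
  have hj := P.part_mem.2 (Finset.mem_univ j)
  obtain ⟨k, hk⟩ : ((P.part i).erase i).Nonempty := by
    have h3 : ((P.part i).erase i).card = 3 := (johnsonErase h4 hP i).2
    rw [← Finset.card_pos, h3]
    norm_num
  have hk' := hij' ▸ hk
  have hpart : P.part i = P.part j :=
    P.eq_of_mem_parts hi hj (Finset.mem_of_mem_erase hk) (Finset.mem_of_mem_erase hk')
  by_contra hne
  have hmem : i ∈ (P.part j).erase j :=
    Finset.mem_erase.2 ⟨hne, hpart ▸ P.mem_part (Finset.mem_univ i)⟩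
  rw [← hij'] at hmem
  exact Finset.notMem_erase _ _ hmem

theorem exists_johnsonErase_eq_iff {P : Finpartition (Finset.univ : Finset (Fin n))}
    (hP : ∀ t ∈ P.parts, t.card = 4) (v : (johnson n h4).V) :
    (∃ i, johnsonErase h4 hP i = v) ↔ ∃ t ∈ P.parts, v.1 ⊆ t := by
  constructor
  · rintro ⟨i, rfl⟩
    exact ⟨P.part i, P.part_mem.2 (Finset.mem_univ i), Finset.erase_subset _ _⟩
  · rintro ⟨t, ht, hvt⟩
    have hcard : (t \ v.1).card = 1 := by
      rw [Finset.card_sdiff_of_subset hvt, hP t ht, v.2]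
    obtain ⟨i, hi⟩ := Finset.card_eq_one.1 hcard
    have hit : i ∈ t \ v.1 := hi ▸ Finset.mem_singleton_self i
    refine ⟨i, Subtype.ext ?_⟩
    change (P.part i).erase i = v.1
    rw [P.part_eq_of_mem ht (Finset.mem_sdiff.1 hit).1, Finset.erase_eq, ← hi,
      Finset.sdiff_sdiff_eq_self hvt]

/-- A vertex of an edge is determined by the point its part omits, so every edge has exactly `n`
vertices. -/
theorem sum_johnson_edge {β : Type*} [AddCommMonoid β]
    {P : Finpartition (Finset.univ : Finset (Fin n))} (hP : ∀ t ∈ P.parts, t.card = 4)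
    {e : Finset (johnson n h4).V} (he : ∀ v, v ∈ e ↔ ∃ t ∈ P.parts, v.1 ⊆ t)
    (f : (johnson n h4).V → β) : ∑ v ∈ e, f v = ∑ i, f (johnsonErase h4 hP i) := by
  classical
  have : e = Finset.univ.image (johnsonErase h4 hP) := by
    ext v
    simp [he, ← exists_johnsonErase_eq_iff h4 hP]
  rw [this, Finset.sum_image fun i _ j _ h => johnsonErase_injective h4 hP h]

theorem johnson_uniform_mem_probModels (hn : 0 < n) :
    (fun _ => 1 / (n : ℝ)) ∈ (johnson n h4).probModels := by
  refine ⟨fun _ => ⟨by positivity, ?_⟩, ?_⟩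
  · exact (div_le_one (by exact_mod_cast hn)).2 (by exact_mod_cast hn)
  · rintro e ⟨P, hP, he⟩
    rw [sum_johnson_edge h4 hP he]
    simp
    field_simp

theorem card_inter_of_johnson_orthogonal {u v : (johnson n h4).V}
    (h : (johnson n h4).Orthogonal u v) : (u.1 ∩ v.1).card = 0 ∨ (u.1 ∩ v.1).card = 2 := by
  obtain ⟨hne, e, ⟨P, hP, he⟩, hu, hv⟩ := h
  obtain ⟨t, ht, hut⟩ := (he u).1 hu
  obtain ⟨s, hs, hvs⟩ := (he v).1 hv
  have hu3 := u.2
  have hv3 := v.2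
  by_cases hts : t = s
  · subst hts
    -- Two triples in one 4-set have a union of size at most 4, so they share at least 2 points.
    have h1 := Finset.card_union_add_card_inter u.1 v.1
    have h2 := Finset.card_le_card (Finset.union_subset hut hvs)
    rw [hP t ht] at h2
    have h3 : (u.1 ∩ v.1).card ≠ 3 := fun h3 => hne <| Subtype.ext <|
      (Finset.eq_of_subset_of_card_le Finset.inter_subset_left (by omega)).symm.trans
        (Finset.eq_of_subset_of_card_le Finset.inter_subset_right (by omega))
    have h4 := Finset.card_le_card (Finset.inter_subset_left (s₁ := u.1) (s₂ := v.1))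
    omega
  · left
    rw [Finset.card_eq_zero]
    exact Finset.disjoint_iff_inter_eq_empty.1
      ((P.disjoint ht hs hts).mono hut hvs)

theorem johnson_hasOrthonormalRep : (johnson n h4).HasOrthonormalRep (ZMod 2) n := by
  have key : ∀ u v : (johnson n h4).V,
      (fun i => if i ∈ u.1 then (1 : ZMod 2) else 0) ⬝ᵥ (fun i => if i ∈ v.1 then 1 else 0) =
        ((u.1 ∩ v.1).card : ZMod 2) := by
    intro u v
    simp [dotProduct, ← ite_and, Finset.sum_boole]
    congr 2
    ext
    simp [and_comm]
  refine ⟨Fin n, inferInstance, fun v i => if i ∈ v.1 then 1 else 0, Fintype.card_fin n,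
    fun v => ?_, fun u v h => ?_⟩
  · rw [key, Finset.inter_self, v.2]
    decide
  · rw [key]
    rcases card_inter_of_johnson_orthogonal h4 h with h | h <;> rw [h] <;> decide

/-- Two pairs of subsets of a finite type with equal cardinalities are related by a permutation. -/
theorem exists_perm_map_eq {α : Type*} [Fintype α] [DecidableEq α] {x y x' y' : Finset α}
    (hx : x.card = x'.card) (hy : y.card = y'.card) (hxy : (x ∩ y).card = (x' ∩ y').card) :
    ∃ σ : Equiv.Perm α, x.map σ.toEmbedding = x' ∧ y.map σ.toEmbedding = y' := by
  -- `c` records the Venn cell of a point; bijections between corresponding cells glue to `σ`.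
  let c (x y : Finset α) (i : α) : Bool × Bool := (decide (i ∈ x), decide (i ∈ y))
  have fib (b : Bool × Bool) : Fintype.card {i // c x y i = b} =
      Fintype.card {i // c x' y' i = b} := by
    rw [Fintype.card_subtype, Fintype.card_subtype]
    have e11 (x y : Finset α) : (Finset.univ.filter fun i => c x y i = (true, true)) = x ∩ y := by
      ext; simp [c]
    have e10 (x y : Finset α) : (Finset.univ.filter fun i => c x y i = (true, false)) = x \ y := by
      ext; simp [c]
    have e01 (x y : Finset α) : (Finset.univ.filter fun i => c x y i = (false, true)) = y \ x := by
      ext; simp [c, and_comm]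
    have e00 (x y : Finset α) :
        (Finset.univ.filter fun i => c x y i = (false, false)) = (x ∪ y)ᶜ := by
      ext; simp [c]
    have h1 := Finset.card_inter_add_card_sdiff x y
    have h2 := Finset.card_inter_add_card_sdiff x' y'
    have h3 := Finset.card_inter_add_card_sdiff y x
    have h4 := Finset.card_inter_add_card_sdiff y' x'
    have h5 := Finset.card_union_add_card_inter x y
    have h6 := Finset.card_union_add_card_inter x' y'
    rw [Finset.inter_comm] at h3 h4
    rcases b with ⟨_ | _, _ | _⟩
    · rw [e00, e00, Finset.card_compl, Finset.card_compl]
      omega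
    · rw [e01, e01]
      omega
    · rw [e10, e10]
      omega
    · rw [e11, e11]
      omega
  let σ : Equiv.Perm α := Equiv.ofFiberEquiv fun b => Fintype.equivOfCardEq (fib b)
  have hσ (i : α) : c x' y' (σ i) = c x y i := Equiv.ofFiberEquiv_map _ i
  have hσx (i : α) : σ i ∈ x' ↔ i ∈ x := by simpa [c] using congrArg Prod.fst (hσ i)
  have hσy (i : α) : σ i ∈ y' ↔ i ∈ y := by simpa [c] using congrArg Prod.snd (hσ i)
  refine ⟨σ, ?_, ?_⟩
  · ext i
    rw [Finset.mem_map_equiv, ← hσx, Equiv.apply_symm_apply]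
  · ext i
    rw [Finset.mem_map_equiv, ← hσy, Equiv.apply_symm_apply]

/-- The action of permutations on the vertices. -/
def johnsonMap (σ : Equiv.Perm (Fin n)) (v : (johnson n h4).V) : (johnson n h4).V :=
  ⟨v.1.map σ.toEmbedding, (Finset.card_map _).trans v.2⟩

theorem johnsonMap_mul (σ τ : Equiv.Perm (Fin n)) (v : (johnson n h4).V) :
    johnsonMap h4 (σ * τ) v = johnsonMap h4 σ (johnsonMap h4 τ v) :=
  Subtype.ext (Finset.map_map τ.toEmbedding σ.toEmbedding v.1).symm

theorem card_inter_johnsonMap (σ : Equiv.Perm (Fin n)) (u v : (johnson n h4).V) :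
    ((johnsonMap h4 σ u).1 ∩ (johnsonMap h4 σ v).1).card = (u.1 ∩ v.1).card := by
  rw [johnsonMap, johnsonMap, ← Finset.map_inter, Finset.card_map]

theorem card_block {n : ℕ} (h4 : 4 ∣ n) (i : Fin n) :
    (Finset.univ.filter fun j : Fin n => j.1 / 4 = i.1 / 4).card = 4 := by
  have : (Finset.univ.filter fun j : Fin n => j.1 / 4 = i.1 / 4).map Fin.valEmbedding =
      Finset.Ico (4 * (i.1 / 4)) (4 * (i.1 / 4) + 4) := by
    ext k
    simp only [Finset.mem_map, Finset.mem_filter, Finset.mem_univ, true_and, Finset.mem_Ico,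
      Fin.valEmbedding_apply]
    constructor
    · rintro ⟨j, hj, rfl⟩
      omega
    · intro hk
      have := i.2
      exact ⟨⟨k, by omega⟩, by simp only []; omega, rfl⟩
  rw [← Finset.card_map Fin.valEmbedding, this, Nat.card_Ico]
  omega

/-- The vertex consisting of the other three elements of the block of `i` in the partition of
`Fin n` into blocks of four consecutive elements. -/
def blockVertex (i : Fin n) : (johnson n h4).V :=
  ⟨(Finset.univ.filter fun j => j.1 / 4 = i.1 / 4).erase i, by
    rw [Finset.card_erase_of_mem (by simp), card_block h4]⟩

/-- The edge is the `σ`-translate of the consecutive-block edge. Its index set does not depend on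
`σ`, so sums over edges and over permutations can be exchanged. -/
theorem exists_johnson_edge (σ : Equiv.Perm (Fin n)) :
    ∃ e ∈ (johnson n h4).edges, (∀ i, johnsonMap h4 σ (blockVertex h4 i) ∈ e) ∧
      ∀ f : (johnson n h4).V → ℂ, ∑ v ∈ e, f v = ∑ i, f (johnsonMap h4 σ (blockVertex h4 i)) := by
  classical
  let P : Finpartition (Finset.univ : Finset (Fin n)) :=
    Finpartition.ofSetoid (Setoid.ker fun i => (σ.symm i).1 / 4)
  have hpart (i : Fin n) : P.part (σ i) =
      (Finset.univ.filter fun j : Fin n => j.1 / 4 = i.1 / 4).map σ.toEmbedding := by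
    ext j
    simp only [P, Finpartition.mem_part_ofSetoid_iff_rel, Setoid.ker_def, Finset.mem_map_equiv,
      Equiv.symm_apply_apply, Finset.mem_filter, Finset.mem_univ, true_and]
    exact eq_comm
  have hP : ∀ t ∈ P.parts, t.card = 4 := by
    intro t ht
    obtain ⟨j, hj⟩ := P.nonempty_of_mem_parts ht
    obtain ⟨i, rfl⟩ := σ.surjective j
    rw [← P.part_eq_of_mem ht hj, hpart, Finset.card_map, card_block h4]
  have herase (i : Fin n) : johnsonErase h4 hP (σ i) = johnsonMap h4 σ (blockVertex h4 i) := by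
    refine Subtype.ext ?_
    change (P.part (σ i)).erase (σ i) = Finset.map _ (Finset.erase _ i)
    rw [hpart, Finset.map_erase]
    rfl
  have hedge (v : (johnson n h4).V) : v ∈ Finset.univ.image (johnsonErase h4 hP) ↔
      ∃ t ∈ P.parts, v.1 ⊆ t := by
    rw [← exists_johnsonErase_eq_iff h4 hP]
    simp
  refine ⟨Finset.univ.image (johnsonErase h4 hP), ⟨P, hP, hedge⟩, fun i => ?_, fun f => ?_⟩
  · rw [← herase]
    exact Finset.mem_image_of_mem _ (Finset.mem_univ _)
  · rw [sum_johnson_edge h4 hP hedge]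
    simp only [← herase]
    exact (Equiv.sum_comp σ fun i => f (johnsonErase h4 hP i)).symm

theorem card_filter_val {m : ℕ} (hn : m ≤ n) (p : ℕ → Prop) [DecidablePred p]
    (hp : ∀ i, p i → i < m) :
    (Finset.univ.filter fun i : Fin n => p i).card = ((Finset.range m).filter p).card := by
  rw [← Finset.card_map Fin.valEmbedding]
  congr 1
  ext k
  simp only [Finset.mem_map, Finset.mem_filter, Finset.mem_univ, true_and, Finset.mem_range,
    Fin.valEmbedding_apply]
  constructor
  · rintro ⟨i, hi, rfl⟩
    exact ⟨hp _ hi, hi⟩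
  · rintro ⟨hk, hpk⟩
    exact ⟨⟨k, by omega⟩, hpk, rfl⟩

/-- The number of elements of `S`, other than `i`, in the block of `i`. -/
def blockCount (S : Finset ℕ) (i : ℕ) : ℕ :=
  (S.filter fun j => j / 4 = i / 4 ∧ j ≠ i).card

theorem card_blockVertex_inter {S : Finset ℕ} (hS : ∀ j ∈ S, j < n) {x : Finset (Fin n)}
    (hx : ∀ j, j ∈ x ↔ j.1 ∈ S) (i : Fin n) :
    ((blockVertex h4 i).1 ∩ x).card = blockCount S i := by
  rw [blockCount, ← Finset.card_map Fin.valEmbedding]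
  congr 1
  ext k
  simp only [blockVertex, Finset.mem_map, Finset.mem_inter, Finset.mem_erase, Finset.mem_filter,
    Finset.mem_univ, true_and, Fin.valEmbedding_apply, hx]
  constructor
  · rintro ⟨j, ⟨⟨hji, hj⟩, hjS⟩, rfl⟩
    exact ⟨hjS, hj, fun h => hji (Fin.ext h)⟩
  · rintro ⟨hk, hki, hne⟩
    exact ⟨⟨k, hS k hk⟩, ⟨⟨fun h => hne (congrArg Fin.val h), hki⟩, hk⟩, rfl⟩

theorem exists_vertex_of_finset {S : Finset ℕ} (hS : ∀ j ∈ S, j < n) (hS3 : S.card = 3) :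
    ∃ x : (johnson n h4).V, ∀ j, j ∈ x.1 ↔ j.1 ∈ S := by
  refine ⟨⟨Finset.univ.filter fun j => j.1 ∈ S, ?_⟩, fun j => by simp⟩
  rw [card_filter_val le_rfl (· ∈ S) hS, ← hS3]
  congr 1
  ext j
  simpa using hS j

theorem johnson_orthogonal_of_card_inter (hn : 12 ≤ n) {u v : (johnson n h4).V}
    (h : (u.1 ∩ v.1).card = 0 ∨ (u.1 ∩ v.1).card = 2) : (johnson n h4).Orthogonal u v := by
  have hne : u ≠ v := by
    rintro rfl
    rw [Finset.inter_self, u.2] at h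
    omega
  -- Model pairs within one edge: `{4, 5, 6}` and `{0, 1, 3}`, each against `{0, 1, 2}`.
  obtain ⟨i, hi⟩ : ∃ i : Fin n, (u.1 ∩ v.1).card = blockCount {0, 1, 2} i := by
    rcases h with h | h
    · exact ⟨⟨7, by omega⟩, h.trans (by decide : 0 = blockCount {0, 1, 2} 7)⟩
    · exact ⟨⟨2, by omega⟩, h.trans (by decide : 2 = blockCount {0, 1, 2} 2)⟩
  have hx : ∀ j : Fin n, j ∈ (blockVertex h4 ⟨3, by omega⟩).1 ↔ j.1 ∈ ({0, 1, 2} : Finset ℕ) := by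
    intro j
    simp [blockVertex, Fin.ext_iff]
    omega
  rw [← card_blockVertex_inter h4 (by simp; omega) hx i] at hi
  obtain ⟨σ, hσu, hσv⟩ := exists_perm_map_eq
    ((blockVertex h4 i).2.trans u.2.symm) ((blockVertex h4 _).2.trans v.2.symm) hi.symm
  obtain ⟨e, he, hmem, -⟩ := exists_johnson_edge h4 σ
  have hu : johnsonMap h4 σ (blockVertex h4 i) = u := Subtype.ext hσu
  have hv : johnsonMap h4 σ (blockVertex h4 ⟨3, by omega⟩) = v := Subtype.ext hσv
  exact ⟨hne, e, he, hu ▸ hmem i, hv ▸ hmem _⟩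

/-- If `F` depends only on the size of intersections and vanishes on orthogonal pairs, the sum of
its values over an edge is controlled by the number of vertices meeting `x` in one element. -/
theorem sum_blockVertex_eq (hn : 12 ≤ n)
    {F : (johnson n h4).V → (johnson n h4).V → ℂ} {a : ℂ}
    (h0 : ∀ u v, (u.1 ∩ v.1).card = 0 ∨ (u.1 ∩ v.1).card = 2 → F u v = 0)
    (h1 : ∀ u v, (u.1 ∩ v.1).card = 1 → F u v = a)
    {S : Finset ℕ} (hS : S ⊆ Finset.range 12)
    (hS2 : ∀ i ∈ Finset.range 12, blockCount S i ≤ 2)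
    {x : (johnson n h4).V} (hx : ∀ j, j ∈ x.1 ↔ j.1 ∈ S) :
    ∑ i, F (blockVertex h4 i) x =
      (((Finset.range 12).filter fun i => blockCount S i = 1).card : ℂ) * a := by
  have hS' : ∀ i, 12 ≤ i → blockCount S i = 0 := by
    intro i hi
    rw [blockCount, Finset.card_eq_zero, Finset.filter_eq_empty_iff]
    intro j hj
    have := Finset.mem_range.1 (hS hj)
    omega
  have hF (i : Fin n) : F (blockVertex h4 i) x = if blockCount S i = 1 then a else 0 := by
    have hc := card_blockVertex_inter h4
      (fun j hj => (Finset.mem_range.1 (hS hj)).trans_le hn) hx i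
    split_ifs with h
    · exact h1 _ _ (hc.trans h)
    · refine h0 _ _ ?_
      rw [hc]
      by_cases hi : i.1 < 12
      · have := hS2 i (Finset.mem_range.2 hi)
        omega
      · exact Or.inl (hS' i (by omega))
  simp only [hF]
  rw [← Finset.sum_filter, Finset.sum_const, nsmul_eq_mul,
    card_filter_val hn (fun i => blockCount S i = 1)]
  intro i hi
  by_contra hlt
  rw [hS' i (by omega)] at hi
  omega

theorem johnson_npaLevel_one (hn : 12 ≤ n) : (johnson n h4).npaLevel 1 = ∅ := by
  rw [Set.eq_empty_iff_forall_notMem]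
  rintro p ⟨-, M, hpos, hM1, hsum, horth, -⟩
  have hherm (v : (johnson n h4).V) : M [v] [] = star (M [] [v]) :=
    (hpos.1.apply ⟨[v], by simp⟩ ⟨[], by simp⟩).symm
  -- Unnormalised averages over the symmetric group.
  let F (u v : (johnson n h4).V) : ℂ :=
    ∑ σ : Equiv.Perm (Fin n), M [johnsonMap h4 σ u] [johnsonMap h4 σ v]
  let G (v : (johnson n h4).V) : ℂ := ∑ σ : Equiv.Perm (Fin n), M [] [johnsonMap h4 σ v]
  have hrow (w : List (johnson n h4).V) (hw : w.length ≤ 1) (σ : Equiv.Perm (Fin n)) :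
      ∑ i, M [johnsonMap h4 σ (blockVertex h4 i)] w = M [] w := by
    obtain ⟨e, he, -, hes⟩ := exists_johnson_edge h4 σ
    rw [← hes fun v => M [v] w]
    exact hsum e he [] w le_rfl hw
  have hFG (x) : ∑ i, F (blockVertex h4 i) x = G x := by
    rw [Finset.sum_comm]
    exact Finset.sum_congr rfl fun σ _ => hrow _ le_rfl σ
  have hF0 (u v : (johnson n h4).V) (h : (u.1 ∩ v.1).card = 0 ∨ (u.1 ∩ v.1).card = 2) :
      F u v = 0 := by
    refine Finset.sum_eq_zero fun σ _ => horth [] [] le_rfl le_rfl _ _ ?_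
    refine johnson_orthogonal_of_card_inter h4 hn ?_
    rwa [card_inter_johnsonMap]
  have htrans (u v u' v' : (johnson n h4).V) (h : (u.1 ∩ v.1).card = (u'.1 ∩ v'.1).card) :
      F u v = F u' v' ∧ G u = G u' := by
    obtain ⟨τ, hu, hv⟩ := exists_perm_map_eq (u.2.trans u'.2.symm) (v.2.trans v'.2.symm) h
    have hu' : johnsonMap h4 τ u = u' := Subtype.ext hu
    have hv' : johnsonMap h4 τ v = v' := Subtype.ext hv
    subst hu' hv'
    simp only [F, G, ← johnsonMap_mul]
    exact ⟨(Equiv.sum_comp (Equiv.mulRight τ)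
        fun σ => M [johnsonMap h4 σ u] [johnsonMap h4 σ v]).symm,
      (Equiv.sum_comp (Equiv.mulRight τ) fun σ => M [] [johnsonMap h4 σ u]).symm⟩
  have hG (u v : (johnson n h4).V) : G u = G v :=
    (htrans u u v v (by rw [Finset.inter_self, Finset.inter_self, u.2, v.2])).2
  -- Neither triple lies in one block, so intersection size 3 never occurs. The second meets three
  -- blocks, whence `12 ≤ n`.
  obtain ⟨x, hx⟩ := exists_vertex_of_finset h4 (S := {0, 1, 4}) (by simp; omega) rfl
  obtain ⟨y, hy⟩ := exists_vertex_of_finset h4 (S := {0, 4, 8}) (by simp; omega) rfl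
  let z := blockVertex h4 ⟨1, by omega⟩
  have hzx : (z.1 ∩ y.1).card = 1 :=
    (card_blockVertex_inter h4 (by simp; omega) hy ⟨1, by omega⟩).trans
      (by decide : blockCount {0, 4, 8} 1 = 1)
  have hF1 (u v : (johnson n h4).V) (h : (u.1 ∩ v.1).card = 1) : F u v = F z y :=
    (htrans u v z y (h.trans hzx.symm)).1
  -- The omitted points giving a single common element are 0, 1, 5, 6, 7.
  have h5 : G x = 5 * F z y := by
    rw [← hFG, sum_blockVertex_eq h4 hn hF0 hF1 (S := {0, 1, 4}) (by decide) (by decide) hx]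
    rfl
  -- Each of the three blocks contributes its three points outside `y`.
  have h9 : G y = 9 * F z y := by
    rw [← hFG, sum_blockVertex_eq h4 hn hF0 hF1 (S := {0, 4, 8}) (by decide) (by decide) hy]
    rfl
  have hG0 (v) : G v = 0 := by
    have := hG x y
    rw [hG v x]
    linear_combination (9 / 4 : ℂ) * h5 - (5 / 4 : ℂ) * h9 - (5 / 4 : ℂ) * this
  -- Edge normalisation makes the same double sum equal to `n!`.
  have htotal : ∑ σ : Equiv.Perm (Fin n), ∑ i, M [johnsonMap h4 σ (blockVertex h4 i)] [] = 0 := by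
    rw [Finset.sum_comm]
    refine Finset.sum_eq_zero fun i _ => ?_
    simp only [hherm]
    rw [← star_sum]
    exact (congrArg star (hG0 _)).trans (star_zero _)
  simp only [hrow [] (Nat.zero_le _), hM1, Finset.sum_const, nsmul_eq_mul, mul_one,
    Nat.cast_eq_zero, Finset.card_univ, Fintype.card_ne_zero] at htotal

end Johnson

end ContextualityScenario

theorem mainTheorem5 :
    (∃ H : ContextualityScenario.{0}, H.npaLevel 1 ⊂ H.consistentExclusivityInf) ∧
    ∀ (n : ℕ) (h4 : 4 ∣ n), 12 ≤ n →
      (fun _ => 1 / (n : ℝ)) ∈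
        (ContextualityScenario.johnson n h4).consistentExclusivityInf ∧
      (ContextualityScenario.johnson n h4).npaLevel 1 = ∅ := by
  have key (n : ℕ) (h4 : 4 ∣ n) (hn : 12 ≤ n) :=
    And.intro
      ((ContextualityScenario.johnson_hasOrthonormalRep h4).const_mem_consistentExclusivityInf
        (by omega) (ContextualityScenario.johnson_uniform_mem_probModels h4 (by omega)))
      (ContextualityScenario.johnson_npaLevel_one h4 hn)
  refine ⟨⟨ContextualityScenario.johnson 12 (by norm_num), ?_⟩, key⟩
  obtain ⟨hmem, hempty⟩ := key 12 (by norm_num) le_rfl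
  rw [hempty]
  exact Set.empty_ssubset.2 ⟨_, hmem⟩
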